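/- For an integer $n\ge 1$ and $q>0$, let $\mu_{n,q}$ be the Mallows measure on the symmetric group $S_n$, that is, $\mu_{n,q}(\pi)=q^{\mathrm{inv}(\pi)}/Z_{n,q}$, where $\mathrm{inv}(\pi)=|\{(i,j): i<j,\ \pi(i)>\pi(j)\}|$ and $Z_{n,q}=\sum_{\sigma\in S_n}q^{\mathrm{inv}(\sigma)}$. Let $\mathrm{LIS}(\pi)$ be the maximal $m$ for which there are indices $i_1<\dots<i_m$ with $\pi(i_1)<\dots<\pi(i_m)$. **Theorem.** There exist absolute constants $0<c_0\le C_0<\infty$ such that for all integers $n\ge1$, all real $q$ with $\tfrac12\le q\le 1-\tfrac4n$, and $\pi\sim\mu_{n,q}$, $$c_0\,n\sqrt{1-q}\ \le\ \mathbb{E}(\mathrm{LIS}(\pi))\ \le\ C_0\,n\sqrt{1-q}.$$ Furthermore, there exist absolute constants $0<c,C<\infty$ such that for all such $n$, $q$ and $\pi\sim\mu_{n,q}$: (i) for every integer $L\ge Cn\sqrt{1-q}$, $$\mathbb{P}(\mathrm{LIS}(\pi)\ge L)\le\left(\frac{C(1-q)n^2}{L^2}\right)^L,$$ and if in addition $L\le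 n$, then also $$\left(\frac{c(1-q)n^2}{L^2}\right)^L\le\mathbb{P}(\mathrm{LIS}(\pi)\ge L);$$ (ii) for every integer $L$ with $n(1-q)\le L\le cn\sqrt{1-q}$, $$\mathbb{P}(\mathrm{LIS}(\pi)<L)\le\exp\left(-\frac{c(1-q)n^2}{L}\right).$$ -/

import Mathlib

open MeasureTheory

noncomputable section

/-- The finite set `S_n` of permutations of `Fin n` carries the discrete σ-algebra. -/
instance permMeasurableSpace (n : ℕ) : MeasurableSpace (Equiv.Perm (Fin n)) := ⊤

instance permDiscreteMeasurableSpace (n : ℕ) :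
    DiscreteMeasurableSpace (Equiv.Perm (Fin n)) := ⟨fun _ => trivial⟩

/-- The number of inversions of `π`: pairs `i < j` with `π i > π j`. -/
def inversionCount {n : ℕ} (π : Equiv.Perm (Fin n)) : ℕ :=
  (Finset.univ.filter fun p : Fin n × Fin n => p.1 < p.2 ∧ π p.2 < π p.1).card

/-- The normalizing constant `Z_{n,q} = ∑_{π ∈ S_n} q ^ inv(π)`. -/
def mallowsZ (n : ℕ) (q : ℝ) : ℝ :=
  ∑ π : Equiv.Perm (Fin n), q ^ inversionCount π

/-- The `(n,q)`-Mallows measure on `S_n`: the permutation `π` has mass `q ^ inv(π) / Z_{n,q}`. -/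
def mallows (n : ℕ) (q : ℝ) : Measure (Equiv.Perm (Fin n)) :=
  ∑ π : Equiv.Perm (Fin n),
    ENNReal.ofReal (q ^ inversionCount π / mallowsZ n q) • Measure.dirac π

/-- The maximal length `m` of an increasing subsequence `i_1 < ⋯ < i_m`,
`π(i_1) < ⋯ < π(i_m)`, of `π`. The set of such lengths contains `0` and is bounded by `n`
(see `isGreatest_LIS`), so the supremum is a maximum. -/
def LIS {n : ℕ} (π : Equiv.Perm (Fin n)) : ℕ :=
  sSup {m : ℕ | ∃ i : Fin m → Fin n, StrictMono i ∧ StrictMono fun k => π (i k)}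

theorem isGreatest_LIS {n : ℕ} (π : Equiv.Perm (Fin n)) :
    IsGreatest {m : ℕ | ∃ i : Fin m → Fin n, StrictMono i ∧ StrictMono fun k => π (i k)}
      (LIS π) := by
  have hb : BddAbove
      {m : ℕ | ∃ i : Fin m → Fin n, StrictMono i ∧ StrictMono fun k => π (i k)} := by
    refine ⟨n, ?_⟩
    rintro m ⟨i, hi, -⟩
    simpa using Fintype.card_le_of_injective i hi.injective
  refine ⟨Nat.sSup_mem ⟨0, Fin.elim0, fun a => a.elim0, fun a => a.elim0⟩ hb, ?_⟩
  intro m hm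
  exact le_csSup hb hm

theorem mallowsZ_pos (n : ℕ) {q : ℝ} (hq : 0 < q) : 0 < mallowsZ n q :=
  Finset.sum_pos (fun _ _ => pow_pos hq _) Finset.univ_nonempty

theorem isProbabilityMeasure_mallows (n : ℕ) {q : ℝ} (hq : 0 < q) :
    IsProbabilityMeasure (mallows n q) := by
  have hZ := mallowsZ_pos n hq
  constructor
  simp only [mallows, Measure.coe_finsetSum, Finset.sum_apply, Measure.smul_apply,
    measure_univ, smul_eq_mul, mul_one]
  rw [← ENNReal.ofReal_sum_of_nonneg (fun _ _ => by positivity), ← Finset.sum_div]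
  have h : (∑ π : Equiv.Perm (Fin n), q ^ inversionCount π) = mallowsZ n q := rfl
  rw [h, div_self hZ.ne', ENNReal.ofReal_one]

end

/-! Deleting the first entry `p` of a permutation and keeping the relative order of the rest removes
exactly `p` inversions. Hence under the Mallows measure the first value is truncated geometric, with
weights `q ^ p / geomSum q (n + 1)`, and the remaining relative order is an independent Mallows
permutation of size one less. Everything is an induction on this recursion.

Upper tail: prescribing the value at a position followed by many others costs a factor of order `1 -
q`, so a union bound over the positions and values of an increasing subsequence gives two binomials
times `(C(1-q))^L`, that is `(C(1-q)n²/L²)^L`. Positions near the end have too few successors; this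
is cured by embedding the permutation in one of size `2n` as its final block and reversing
(`mallows_real_pinned_le`, `mallows_real_le_LIS_le_choose`).

Lower bounds: read the entries in order, keep the number `R` of unused values below the last
accepted one, and accept an entry whose rank lies in a window of width `w` starting at `R`.
Acceptance has probability of order `(1-q)w` and raises the threshold by at most `w`; when `R`
reaches order `1/(1-q)`, one waits for small values to be used up, each step lowering `R` with
probability bounded below. The potential `A ^ s * exp (b h + x R)`, with `s` steps left and `h`
acceptances missing, bounds the failure probability. To reach lengths beyond the typical one, the
acceptance probability `p` is treated as a larger `p'` at a price `p / p'` per acceptance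
(`mul_max_le_mallows_real_increasingAbove`). Different choices of `w`, `p'`, `b`, `x` give the lower
bound in (i), the bound (ii) and the lower bound on the mean; the upper bound on the mean follows
from the upper tail. -/

/-! ### Recursive structure of the Mallows measure -/

/-- The permutation of `Fin (n + 1)` with first value `p` whose remaining values have the relative
order of `e`. -/
def permCons {n : ℕ} (p : Fin (n + 1)) (e : Equiv.Perm (Fin n)) : Equiv.Perm (Fin (n + 1)) :=
  (Equiv.Perm.decomposeFin.symm (0, e)).trans p.cycleRange.symm

@[simp] theorem permCons_zero {n : ℕ} (p : Fin (n + 1)) (e : Equiv.Perm (Fin n)) :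
    permCons p e 0 = p := by
  simp [permCons]

@[simp] theorem permCons_succ {n : ℕ} (p : Fin (n + 1)) (e : Equiv.Perm (Fin n)) (j : Fin n) :
    permCons p e j.succ = p.succAbove (e j) := by
  simp [permCons]

theorem permCons_bijective (n : ℕ) :
    Function.Bijective fun x : Fin (n + 1) × Equiv.Perm (Fin n) => permCons x.1 x.2 := by
  rw [Fintype.bijective_iff_injective_and_card]
  constructor
  · rintro ⟨p, e⟩ ⟨p', e'⟩ h
    have h0 : p = p' := by simpa using congrArg (fun s : Equiv.Perm (Fin (n + 1)) => s 0) h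
    subst h0
    refine Prod.ext rfl (Equiv.ext fun j => ?_)
    have hj := congrArg (fun s : Equiv.Perm (Fin (n + 1)) => s j.succ) h
    simpa using hj
  · simp [Fintype.card_perm, Nat.factorial_succ]

theorem inversionCount_eq_sum {n : ℕ} (π : Equiv.Perm (Fin n)) :
    inversionCount π = ∑ i, ∑ j, if i < j ∧ π j < π i then 1 else 0 := by
  rw [inversionCount, Finset.card_filter, ← Finset.univ_product_univ, Finset.sum_product]

theorem card_filter_perm_lt {n : ℕ} (p : Fin (n + 1)) (e : Equiv.Perm (Fin n)) :
    (∑ j, if (e j).castSucc < p then 1 else 0) = (p : ℕ) := by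
  rw [Equiv.sum_comp e fun j => if j.castSucc < p then 1 else 0]
  have h := Fin.sum_univ_eq_sum_range (fun k => if k < (p : ℕ) then 1 else 0) n
  simp only [Fin.lt_def, Fin.val_castSucc]
  rw [h, ← Finset.card_filter]
  have : Finset.filter (fun k => k < (p : ℕ)) (Finset.range n) = Finset.range p := by
    ext k; simp; omega
  rw [this, Finset.card_range]

theorem inversionCount_permCons {n : ℕ} (p : Fin (n + 1)) (e : Equiv.Perm (Fin n)) :
    inversionCount (permCons p e) = p + inversionCount e := by
  simp only [inversionCount_eq_sum, Fin.sum_univ_succ, permCons_zero, permCons_succ,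
    Fin.succ_lt_succ_iff, Fin.succAbove_lt_succAbove_iff, Fin.succ_pos, true_and,
    Fin.succAbove_lt_iff_castSucc_lt, Fin.not_lt_zero, false_and, if_false, zero_add]
  rw [card_filter_perm_lt]

/-- The partial geometric sum `1 + q + ⋯ + q ^ (m - 1)`. -/
def geomSum (q : ℝ) (m : ℕ) : ℝ := ∑ k ∈ Finset.range m, q ^ k

theorem geomSum_pos {q : ℝ} (hq : 0 < q) (m : ℕ) : 0 < geomSum q (m + 1) :=
  Finset.sum_pos (fun _ _ => pow_pos hq _) (by simp)

theorem geomSum_mono {q : ℝ} (hq : 0 < q) {m k : ℕ} (h : m ≤ k) : geomSum q m ≤ geomSum q k :=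
  Finset.sum_le_sum_of_subset_of_nonneg (by simpa using h) fun _ _ _ => (pow_pos hq _).le

theorem one_sub_mul_geomSum (q : ℝ) (m : ℕ) : (1 - q) * geomSum q m = 1 - q ^ m :=
  mul_neg_geom_sum q m

theorem sum_perm_succ {n : ℕ} (f : Equiv.Perm (Fin (n + 1)) → ℝ) :
    ∑ π, f π = ∑ p, ∑ e, f (permCons p e) := by
  rw [← (permCons_bijective n).sum_comp f, Fintype.sum_prod_type]

theorem mallowsZ_succ (n : ℕ) (q : ℝ) :
    mallowsZ (n + 1) q = geomSum q (n + 1) * mallowsZ n q := by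
  simp only [mallowsZ, geomSum, sum_perm_succ, inversionCount_permCons, pow_add]
  rw [← Fin.sum_univ_eq_sum_range (fun k => q ^ k), Finset.sum_mul_sum]

open Classical in
theorem mallows_real (n : ℕ) {q : ℝ} (hq : 0 < q) (A : Set (Equiv.Perm (Fin n))) :
    (mallows n q).real A = ∑ π, if π ∈ A then q ^ inversionCount π / mallowsZ n q else 0 := by
  have hZ := mallowsZ_pos n hq
  simp only [measureReal_def, mallows, Measure.coe_finsetSum, Finset.sum_apply, Measure.smul_apply,
    smul_eq_mul]
  rw [ENNReal.toReal_sum]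
  · refine Finset.sum_congr rfl fun π _ => ?_
    have h0 : 0 ≤ q ^ inversionCount π / mallowsZ n q := by positivity
    by_cases h : π ∈ A <;> simp [h, h0]
  · intro π _
    by_cases h : π ∈ A <;> simp [h]

theorem mallows_real_succ (n : ℕ) {q : ℝ} (hq : 0 < q) (A : Set (Equiv.Perm (Fin (n + 1)))) :
    (mallows (n + 1) q).real A =
      ∑ p : Fin (n + 1), q ^ (p : ℕ) / geomSum q (n + 1) *
        (mallows n q).real {e | permCons p e ∈ A} := by
  classical
  have hZ := mallowsZ_pos n hq
  have hG := geomSum_pos hq n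
  simp only [mallows_real _ hq, sum_perm_succ, Finset.mul_sum, Set.mem_ofPred_eq, mallowsZ_succ,
    inversionCount_permCons, mul_ite, mul_zero]
  refine Finset.sum_congr rfl fun p _ => Finset.sum_congr rfl fun e _ => ?_
  congr 1
  field_simp
  ring

theorem sum_geom_weights (n : ℕ) {q : ℝ} (hq : 0 < q) :
    ∑ p : Fin (n + 1), q ^ (p : ℕ) / geomSum q (n + 1) = 1 := by
  rw [← Finset.sum_div, Fin.sum_univ_eq_sum_range (fun k => q ^ k)]
  exact div_self (geomSum_pos hq n).ne'

/-- Reversing both positions and values sends an inversion at `(i, j)` to one at `(rev j, rev i)`.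
-/
theorem inversionCount_rev {n : ℕ} (π : Equiv.Perm (Fin n)) :
    inversionCount (Fin.revPerm.trans (π.trans Fin.revPerm)) = inversionCount π := by
  simp only [inversionCount]
  refine Finset.card_bij' (fun x _ => (x.2.rev, x.1.rev)) (fun x _ => (x.2.rev, x.1.rev))
    ?_ ?_ ?_ ?_ <;> simp

theorem mallows_real_rev (n : ℕ) {q : ℝ} (hq : 0 < q) (A : Set (Equiv.Perm (Fin n))) :
    (mallows n q).real {π | Fin.revPerm.trans (π.trans Fin.revPerm) ∈ A} =
      (mallows n q).real A := by
  classical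
  rw [mallows_real n hq, mallows_real n hq]
  have hinv : Function.Involutive
      fun π : Equiv.Perm (Fin n) => Fin.revPerm.trans (π.trans Fin.revPerm) := by
    intro π; ext i; simp
  rw [← hinv.bijective.sum_comp]
  refine Finset.sum_congr rfl fun x _ => ?_
  rw [inversionCount_rev]
  refine if_congr ?_ rfl rfl
  rw [Set.mem_ofPred_eq]
  exact iff_of_eq (congrArg (· ∈ A) (hinv x))

/-! ### Increasing subsequences and the union bound for the upper tail -/

theorem le_LIS_iff {n : ℕ} (π : Equiv.Perm (Fin n)) (L : ℕ) :
    L ≤ LIS π ↔ ∃ i : Fin L → Fin n, StrictMono i ∧ StrictMono fun k => π (i k) := by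
  constructor
  · intro h
    obtain ⟨i, hi, hπ⟩ := (isGreatest_LIS π).1
    exact ⟨i ∘ Fin.castLE h, hi.comp (Fin.strictMono_castLE h),
      hπ.comp (Fin.strictMono_castLE h)⟩
  · intro h
    exact (isGreatest_LIS π).2 h

theorem LIS_le {n : ℕ} (π : Equiv.Perm (Fin n)) : LIS π ≤ n := by
  obtain ⟨i, hi, -⟩ := (isGreatest_LIS π).1
  simpa using Fintype.card_le_of_injective i hi.injective

/-- Once the first value is `p`, a prescribed later value becomes a prescribed relative rank. A
value that `p` excludes makes the condition impossible, so its rank may be arbitrary. -/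
theorem exists_succAbove_section {n : ℕ} (p : Fin (n + 1)) (v : Fin (n + 1) → Fin (n + 1)) :
    ∃ v' : Fin n → Fin n, ∀ j u : Fin n, p.succAbove u = v j.succ → u = v' j := by
  classical
  refine ⟨fun j => if h : ∃ u, p.succAbove u = v j.succ then h.choose else j, fun j u hu => ?_⟩
  have h : ∃ u, p.succAbove u = v j.succ := ⟨u, hu⟩
  simp only [h, dif_pos]
  exact Fin.succAbove_right_injective (hu.trans h.choose_spec.symm)

/-- Prescribing the values at positions followed by at least `m - 1` others costs a factor
`1 / (1 + q + ⋯ + q ^ (m - 1))` per position. -/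
theorem mallows_real_pinned_le {q : ℝ} (hq : 0 < q) (hq1 : q ≤ 1) {m : ℕ} (hm : 1 ≤ m) (N : ℕ)
    (S : Finset (Fin N)) (v : Fin N → Fin N) (hS : ∀ i ∈ S, (i : ℕ) + m ≤ N) :
    (mallows N q).real {π | ∀ i ∈ S, π i = v i} ≤ (geomSum q m)⁻¹ ^ S.card := by
  classical
  obtain ⟨m, rfl⟩ := Nat.exists_eq_add_of_le' hm
  have hGm := geomSum_pos hq m
  induction N with
  | zero =>
    have := isProbabilityMeasure_mallows 0 hq
    have : S.card = 0 := by simp [Finset.eq_empty_of_isEmpty S]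
    simp [this]
  | succ N ih =>
    have hG := geomSum_pos hq N
    have := isProbabilityMeasure_mallows N hq
    let S' : Finset (Fin N) := Finset.univ.filter fun j => j.succ ∈ S
    have hcard : S.card = (if (0 : Fin (N + 1)) ∈ S then 1 else 0) + S'.card := by
      have h1 : S = Finset.univ.filter (fun i => i ∈ S) := by simp
      conv_lhs => rw [h1, Finset.card_filter, Fin.sum_univ_succ]
      rw [Finset.card_filter]
    have hrest : ∀ p : Fin (N + 1), (mallows N q).real
        {e | permCons p e ∈ {π : Equiv.Perm (Fin (N + 1)) | ∀ i ∈ S, π i = v i}} ≤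
          (geomSum q (m + 1))⁻¹ ^ S'.card := by
      intro p
      obtain ⟨v', hv'⟩ := exists_succAbove_section p v
      refine le_trans (measureReal_mono ?_) (ih S' v' ?_)
      · intro e he j hj
        exact hv' j (e j) (by simpa using he j.succ (by simpa [S'] using hj))
      · intro i hi
        have := hS i.succ (by simpa [S'] using hi)
        simp at this; omega
    rw [mallows_real_succ N hq, hcard]
    -- If position `0` is pinned, only the term `p = v 0` survives, with weight at most `1 / geomSum
    -- q (N + 1)`; otherwise the weights average out to `1`.
    by_cases h0 : (0 : Fin (N + 1)) ∈ S
    · rw [if_pos h0, pow_add, pow_one]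
      rw [Finset.sum_eq_single (v 0)]
      · refine mul_le_mul ?_ (hrest _) measureReal_nonneg (by positivity)
        rw [div_eq_mul_inv]
        have hmN : m + 1 ≤ N + 1 := by simpa using hS 0 h0
        have h2 : (geomSum q (N + 1))⁻¹ ≤ (geomSum q (m + 1))⁻¹ :=
          inv_anti₀ hGm (geomSum_mono hq hmN)
        have h3 : q ^ ((v 0 : Fin (N + 1)) : ℕ) ≤ 1 := pow_le_one₀ hq.le hq1
        calc _ ≤ 1 * (geomSum q (N + 1))⁻¹ := by gcongr
          _ ≤ _ := by simpa using h2
      · intro p _ hp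
        have : {e | permCons p e ∈ {π : Equiv.Perm (Fin (N + 1)) | ∀ i ∈ S, π i = v i}} = ∅ := by
          ext e
          simp only [Set.mem_ofPred_eq, Set.mem_empty_iff_false, iff_false]
          intro h
          exact hp (by simpa using h 0 h0)
        rw [this]; simp
      · simp
    · rw [if_neg h0, zero_add]
      calc _ ≤ ∑ p : Fin (N + 1), q ^ (p : ℕ) / geomSum q (N + 1) *
              (geomSum q (m + 1))⁻¹ ^ S'.card := by
            refine Finset.sum_le_sum fun p _ => ?_
            exact mul_le_mul_of_nonneg_left (hrest p) (by positivity)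
        _ = _ := by rw [← Finset.sum_mul, sum_geom_weights N hq, one_mul]

/-- Two permutations that are increasing on `S` with the same image agree on `S`. -/
theorem eq_on_of_strictMonoOn_of_image_eq {N : ℕ} {S : Finset (Fin N)} {π π' : Equiv.Perm (Fin N)}
    (h : StrictMonoOn π S) (h' : StrictMonoOn π' S) (him : S.image π = S.image π') :
    ∀ i ∈ S, π i = π' i := by
  have hc : (S.image π').card = S.card := Finset.card_image_of_injective S π'.injective
  have hmem : ∀ x, S.orderEmbOfFin rfl x ∈ S := fun x => Finset.orderEmbOfFin_mem _ _ _
  have e1 := Finset.orderEmbOfFin_unique hc (f := fun x => π (S.orderEmbOfFin rfl x))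
    (fun x => him ▸ Finset.mem_image_of_mem π (hmem x))
    (fun x y hxy => h (hmem x) (hmem y) ((S.orderEmbOfFin rfl).strictMono hxy))
  have e2 := Finset.orderEmbOfFin_unique hc (f := fun x => π' (S.orderEmbOfFin rfl x))
    (fun x => Finset.mem_image_of_mem π' (hmem x))
    (fun x y hxy => h' (hmem x) (hmem y) ((S.orderEmbOfFin rfl).strictMono hxy))
  intro i hi
  have : i ∈ Set.range (S.orderEmbOfFin rfl) := by simpa using hi
  obtain ⟨x, rfl⟩ := this
  exact congrFun (e1.trans e2.symm) x

/-- Union bound over the positions and values of an increasing subsequence. -/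
theorem mallows_real_exists_increasing_le {q : ℝ} (hq : 0 < q) (hq1 : q ≤ 1) {m : ℕ} (hm : 1 ≤ m)
    (N L : ℕ) :
    (mallows N q).real {π | ∃ i : Fin L → Fin N, StrictMono i ∧ (StrictMono fun k => π (i k)) ∧
        ∀ k, (i k : ℕ) + m ≤ N} ≤
      ((N + 1 - m).choose L * N.choose L) * (geomSum q m)⁻¹ ^ L := by
  classical
  have := isProbabilityMeasure_mallows N hq
  let T : Finset (Fin N) := Finset.univ.filter fun i => (i : ℕ) + m ≤ N
  have hT : T.card ≤ N + 1 - m := by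
    have : T.card = (T.image fun i : Fin N => (i : ℕ)).card :=
      (Finset.card_image_of_injective _ Fin.val_injective).symm
    rw [this]
    calc _ ≤ (Finset.range (N + 1 - m)).card := by
          refine Finset.card_le_card fun k hk => ?_
          simp only [T, Finset.mem_image, Finset.mem_filter, Finset.mem_univ, true_and] at hk
          obtain ⟨i, hi, rfl⟩ := hk
          simp only [Finset.mem_range]; omega
      _ = _ := Finset.card_range _
  let Ev : Finset (Fin N) × Finset (Fin N) → Set (Equiv.Perm (Fin N)) :=
    fun x => {π | StrictMonoOn π x.1 ∧ x.1.image π = x.2}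
  let I := T.powersetCard L ×ˢ (Finset.univ : Finset (Fin N)).powersetCard L
  have hEv : ∀ x ∈ I, (mallows N q).real (Ev x) ≤ (geomSum q m)⁻¹ ^ L := by
    rintro ⟨S, V⟩ hx
    simp only [I, Finset.mem_product, Finset.mem_powersetCard] at hx
    obtain ⟨⟨hST, hSL⟩, -⟩ := hx
    obtain ⟨m, rfl⟩ := Nat.exists_eq_add_of_le' hm
    have := geomSum_pos hq m
    -- Positions and value set determine the values of an increasing sequence, so any one witness
    -- `π₀` turns the event into a pinned event.
    rcases (Ev (S, V)).eq_empty_or_nonempty with h | ⟨π₀, hπ₀⟩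
    · rw [h]; simpa using by positivity
    · rw [← hSL]
      refine le_trans (measureReal_mono ?_) (mallows_real_pinned_le hq hq1 hm N S π₀ ?_)
      · intro π hπ
        exact eq_on_of_strictMonoOn_of_image_eq hπ.1 hπ₀.1 (hπ.2.trans hπ₀.2.symm)
      · intro i hi
        simpa [T] using hST hi
  calc _ ≤ (mallows N q).real (⋃ x ∈ I, Ev x) := by
        refine measureReal_mono ?_ (measure_ne_top _ _)
        rintro π ⟨i, hi, hπ, hm⟩
        simp only [Set.mem_iUnion]
        refine ⟨(Finset.univ.image i, (Finset.univ.image i).image π), ?_, ?_, rfl⟩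
        · simp only [I, Finset.mem_product, Finset.mem_powersetCard, Finset.subset_univ, true_and]
          rw [Finset.card_image_of_injective _ π.injective,
            Finset.card_image_of_injective _ hi.injective]
          refine ⟨⟨?_, by simp⟩, by simp⟩
          intro x hx
          simp only [Finset.mem_image, Finset.mem_univ, true_and] at hx
          obtain ⟨k, rfl⟩ := hx
          simpa [T] using hm k
        · intro x hx y hy hxy
          simp only [Finset.coe_image, Finset.coe_univ, Set.image_univ, Set.mem_range] at hx hy
          obtain ⟨k, rfl⟩ := hx
          obtain ⟨l, rfl⟩ := hy
          exact hπ (hi.lt_iff_lt.1 hxy)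
    _ ≤ ∑ x ∈ I, (mallows N q).real (Ev x) := measureReal_biUnion_finset_le _ _
    _ ≤ ∑ _x ∈ I, (geomSum q m)⁻¹ ^ L := Finset.sum_le_sum hEv
    _ ≤ _ := by
        rw [Finset.sum_const, nsmul_eq_mul]
        obtain ⟨m, rfl⟩ := Nat.exists_eq_add_of_le' hm
        have := geomSum_pos hq m
        refine mul_le_mul_of_nonneg_right ?_ (by positivity)
        simp only [I, Finset.card_product, Finset.card_powersetCard, Finset.card_univ,
          Fintype.card_fin]
        exact_mod_cast Nat.mul_le_mul_right _ (Nat.choose_le_choose L hT)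

/-- The last `n` entries of a Mallows permutation of size `n + d` have the relative order of a
Mallows permutation of size `n`. -/
theorem mallows_real_le_tail {q : ℝ} (hq : 0 < q) (n d L : ℕ) :
    (mallows n q).real {σ | L ≤ LIS σ} ≤ (mallows (n + d) q).real
      {π | ∃ i : Fin L → Fin (n + d), StrictMono i ∧ (StrictMono fun k => π (i k)) ∧
        ∀ k, d ≤ (i k : ℕ)} := by
  induction d with
  | zero => simp [le_LIS_iff]
  | succ d ih =>
    refine ih.trans ?_
    have hG := geomSum_pos hq (n + d)
    have := isProbabilityMeasure_mallows (n + d) hq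
    rw [show n + (d + 1) = n + d + 1 from rfl, mallows_real_succ _ hq, ← one_mul (Measure.real _ _),
      ← sum_geom_weights (n + d) hq, Finset.sum_mul]
    refine Finset.sum_le_sum fun p _ => mul_le_mul_of_nonneg_left (measureReal_mono ?_)
      (by positivity)
    rintro e ⟨i, hi, he, hd⟩
    refine ⟨fun k => (i k).succ, fun a b h => by simpa using hi h, fun a b h => ?_, fun k => ?_⟩
    · simpa using he h
    · simpa using hd k

/-- In size `2n`, reversal moves the final block to the first `n` positions, each of which, counting
itself, has at least `n + 1` positions left. This makes the cost per position uniform, at the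
expense of `2n` instead of `n` possible values. -/
theorem mallows_real_le_LIS_le_choose {q : ℝ} (hq : 0 < q) (hq1 : q ≤ 1) (n L : ℕ) :
    (mallows n q).real {σ | L ≤ LIS σ} ≤
      (n.choose L * (2 * n).choose L) * (geomSum q (n + 1))⁻¹ ^ L := by
  refine (mallows_real_le_tail hq n n L).trans ?_
  rw [← mallows_real_rev (n + n) hq]
  have := isProbabilityMeasure_mallows (n + n) hq
  have h := mallows_real_exists_increasing_le hq hq1 (m := n + 1) (by omega) (n + n) L
  rw [show n + n + 1 - (n + 1) = n by omega] at h
  rw [two_mul]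
  refine le_trans (measureReal_mono ?_) h
  rintro π ⟨i, hi, hπ, hd⟩
  refine ⟨fun k => (i k.rev).rev, fun a b h => ?_, fun a b h => ?_, fun k => ?_⟩
  · simpa using hi (Fin.rev_lt_rev.2 h)
  · simpa using hπ (Fin.rev_lt_rev.2 h)
  · have := hd k.rev
    simp only [Fin.val_rev]
    have := (i k.rev).isLt
    omega

theorem choose_le_exp_mul_div_pow (n L : ℕ) :
    (n.choose L : ℝ) ≤ (Real.exp 1 * n / L) ^ L := by
  rcases Nat.eq_zero_or_pos L with rfl | hL
  · simp
  have hL' : (0 : ℝ) < L := by exact_mod_cast hL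
  have h1 : (n.choose L : ℝ) ≤ n ^ L / L.factorial := Nat.choose_le_pow_div L n
  have h2 : (L : ℝ) ^ L / L.factorial ≤ Real.exp L := Real.pow_div_factorial_le_exp L hL'.le L
  have h3 : (0 : ℝ) < L.factorial := by exact_mod_cast L.factorial_pos
  refine h1.trans ?_
  rw [div_pow, mul_pow, ← Real.exp_nat_mul, mul_one, div_le_div_iff₀ h3 (by positivity)]
  rw [div_le_iff₀ h3] at h2
  nlinarith [pow_nonneg (Nat.cast_nonneg (α := ℝ) n) L]

/-- Since `n(1-q) ≥ 4`, `q ^ (n + 1) ≤ 1/4` and the cost per position is at most `4/3 (1-q)`. The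
constant `32` bounds `e² · 2 · 4/3`, using `e² ≤ 12`. -/
theorem mallows_real_le_LIS_le {n : ℕ} {q : ℝ} (hn : 1 ≤ n) (hq : 1 / 2 ≤ q)
    (hqn : q ≤ 1 - 4 / (n : ℝ)) (L : ℕ) :
    (mallows n q).real {σ | L ≤ LIS σ} ≤ (32 * (1 - q) * (n : ℝ) ^ 2 / (L : ℝ) ^ 2) ^ L := by
  have hn' : (0 : ℝ) < n := by exact_mod_cast hn
  have hq0 : 0 < q := by linarith
  have h4 : 0 < 4 / (n : ℝ) := by positivity
  have hq1 : q < 1 := by linarith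
  have hG := geomSum_pos hq0 n
  have hpow : q ^ (n + 1) ≤ 1 / 4 := by
    have h5 : q ^ (n + 1) ≤ Real.exp (-4) := by
      calc q ^ (n + 1) ≤ q ^ n := pow_le_pow_of_le_one hq0.le hq1.le (by omega)
        _ ≤ (Real.exp (-(4 / n))) ^ n := by
            refine pow_le_pow_left₀ hq0.le ?_ n
            linarith [Real.add_one_le_exp (-(4 / (n : ℝ)))]
        _ = Real.exp (-4) := by
            rw [← Real.exp_nat_mul]; congr 1; field_simp
    have h6 : (4 : ℝ) ≤ Real.exp 4 := by linarith [Real.add_one_le_exp (4 : ℝ)]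
    rw [Real.exp_neg] at h5
    exact h5.trans (by rw [one_div]; exact inv_anti₀ (by norm_num) h6)
  have hinv : (geomSum q (n + 1))⁻¹ ≤ 4 / 3 * (1 - q) := by
    rw [inv_le_iff_one_le_mul₀ hG]
    have := one_sub_mul_geomSum q (n + 1)
    nlinarith
  refine (mallows_real_le_LIS_le_choose hq0 hq1.le n L).trans ?_
  have he : Real.exp 1 ^ 2 ≤ 12 := by
    have h1 := Real.exp_one_lt_d9
    have h2 := Real.exp_pos 1
    nlinarith
  calc _ ≤ ((Real.exp 1 * n / L) ^ L * (Real.exp 1 * (2 * n : ℕ) / L) ^ L) *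
          (4 / 3 * (1 - q)) ^ L := by
        gcongr
        · exact choose_le_exp_mul_div_pow n L
        · exact choose_le_exp_mul_div_pow (2 * n) L
    _ = (Real.exp 1 ^ 2 * (8 / 3) * (1 - q) * (n : ℝ) ^ 2 / (L : ℝ) ^ 2) ^ L := by
        rw [← mul_pow, ← mul_pow]; push_cast; congr 1; ring
    _ ≤ _ := by
        have : 0 ≤ 1 - q := by linarith
        gcongr
        linarith

/-! ### Greedy construction of increasing subsequences -/

/-- The permutations with an increasing subsequence of length `h` whose values are at least `R`. -/
def increasingAbove (N h R : ℕ) : Set (Equiv.Perm (Fin N)) :=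
  {σ | ∃ i : Fin h → Fin N, StrictMono i ∧ (StrictMono fun k => σ (i k)) ∧
    ∀ k, R ≤ (σ (i k) : ℕ)}

theorem increasingAbove_zero (N R : ℕ) : increasingAbove N 0 R = Set.univ :=
  Set.eq_univ_of_forall fun _ =>
    ⟨Fin.elim0, fun a => a.elim0, fun a => a.elim0, fun a => a.elim0⟩

theorem le_succAbove_val {n : ℕ} (p : Fin (n + 1)) (u : Fin n) : (u : ℕ) ≤ p.succAbove u := by
  rw [Fin.succAbove]; split_ifs <;> simp

/-- A skipped entry: reinserting `p` never lowers the other values, so the threshold remains valid.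
-/
theorem permCons_mem_increasingAbove {N h R : ℕ} {p : Fin (N + 1)} {e : Equiv.Perm (Fin N)}
    (he : e ∈ increasingAbove N h R) : permCons p e ∈ increasingAbove (N + 1) h R := by
  obtain ⟨i, h1, h2, h3⟩ := he
  refine ⟨fun k => (i k).succ, fun a b hab => by simpa using h1 hab,
    fun a b hab => by simpa using h2 hab, fun k => ?_⟩
  simpa using (h3 k).trans (le_succAbove_val p _)

/-- A skipped entry below the threshold uses up one of the small values, so the threshold drops by
one in relative rank. -/
theorem permCons_mem_increasingAbove_of_lt {N h R : ℕ} {p : Fin (N + 1)} {e : Equiv.Perm (Fin N)}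
    (hp : (p : ℕ) < R) (he : e ∈ increasingAbove N h (R - 1)) :
    permCons p e ∈ increasingAbove (N + 1) h R := by
  obtain ⟨i, h1, h2, h3⟩ := he
  refine ⟨fun k => (i k).succ, fun a b hab => by simpa using h1 hab,
    fun a b hab => by simpa using h2 hab, fun k => ?_⟩
  have := h3 k
  have h4 : p ≤ (e (i k)).castSucc := by simp only [Fin.le_def, Fin.val_castSucc]; omega
  simp only [permCons_succ, Fin.succAbove_of_le_castSucc _ _ h4, Fin.val_succ]
  omega

/-- An accepted entry: among the remaining values, those of relative rank at least `p` are exactly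
the ones above `p`, so any threshold `R' ≥ p` lets the rest be appended. -/
theorem permCons_mem_increasingAbove_succ {N h R R' : ℕ} {p : Fin (N + 1)}
    {e : Equiv.Perm (Fin N)} (hp : R ≤ (p : ℕ)) (hp' : (p : ℕ) ≤ R')
    (he : e ∈ increasingAbove N h R') : permCons p e ∈ increasingAbove (N + 1) (h + 1) R := by
  obtain ⟨i, h1, h2, h3⟩ := he
  have h4 : ∀ k, p < p.succAbove (e (i k)) := fun k => by
    rw [Fin.lt_succAbove_iff_le_castSucc, Fin.le_def, Fin.val_castSucc]
    exact hp'.trans (h3 k)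
  refine ⟨Fin.cons 0 fun k => (i k).succ, ?_, ?_, ?_⟩
  · intro a b hab
    induction b using Fin.cases with
    | zero => simp at hab
    | succ b =>
      induction a using Fin.cases with
      | zero => simp
      | succ a => simpa using h1 (Fin.succ_lt_succ_iff.1 hab)
  · intro a b hab
    induction b using Fin.cases with
    | zero => simp at hab
    | succ b =>
      induction a using Fin.cases with
      | zero => simpa using h4 b
      | succ a => simpa using h2 (Fin.succ_lt_succ_iff.1 hab)
  · intro k
    induction k using Fin.cases with
    | zero => simpa using hp
    | succ k =>
      simp only [Fin.cons_succ, permCons_succ]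
      exact hp.trans (Fin.lt_def.1 (h4 k)).le

/-- One step of the greedy argument: a favourable event of probability at least `α` gives the better
bound `x`, and `z` holds in every case. -/
theorem mix_le_sum_mul {ι : Type*} [Fintype ι] (wt a : ι → ℝ) (P : ι → Prop) [DecidablePred P]
    {x z α : ℝ} (hwt : ∀ i, 0 ≤ wt i) (hsum : ∑ i, wt i = 1)
    (hα : α ≤ ∑ i, if P i then wt i else 0)
    (hx : ∀ i, P i → x ≤ a i) (hz : ∀ i, z ≤ a i) (hzx : z ≤ x) :
    α * x + (1 - α) * z ≤ ∑ i, wt i * a i := by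
  calc α * x + (1 - α) * z = z + α * (x - z) := by ring
    _ ≤ z + (∑ i, if P i then wt i else 0) * (x - z) := by
        have := mul_le_mul_of_nonneg_right hα (sub_nonneg.2 hzx)
        linarith
    _ = ∑ i, wt i * (if P i then x else z) := by
        rw [Finset.sum_mul]
        nth_rewrite 1 [← one_mul z]
        rw [← hsum, Finset.sum_mul, ← Finset.sum_add_distrib]
        refine Finset.sum_congr rfl fun i _ => ?_
        split_ifs <;> ring
    _ ≤ _ := by
        refine Finset.sum_le_sum fun i _ => mul_le_mul_of_nonneg_left ?_ (hwt i)
        split_ifs with h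
        · exact hx i h
        · exact hz i

/-- Truncating the geometric law only increases the weights: `1 / geomSum q (N + 1) ≥ 1 - q`. -/
theorem sum_window_weights {q : ℝ} (hq : 0 < q) (hq1 : q < 1) (N a b : ℕ) (hb : b ≤ N + 1) :
    (1 - q) * ∑ k ∈ Finset.Ico a b, q ^ k ≤
      ∑ p : Fin (N + 1), if a ≤ (p : ℕ) ∧ (p : ℕ) < b then
        q ^ (p : ℕ) / geomSum q (N + 1) else 0 := by
  have hG := geomSum_pos hq N
  have h1 := Fin.sum_univ_eq_sum_range
    (fun k => if a ≤ k ∧ k < b then q ^ k / geomSum q (N + 1) else 0) (N + 1)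
  rw [h1, ← Finset.sum_filter]
  have h2 : Finset.filter (fun k => a ≤ k ∧ k < b) (Finset.range (N + 1)) = Finset.Ico a b := by
    ext k; simp; omega
  rw [h2, Finset.mul_sum]
  refine Finset.sum_le_sum fun k _ => ?_
  rw [le_div_iff₀ hG]
  have := one_sub_mul_geomSum q (N + 1)
  have h3 : 0 < q ^ k := by positivity
  have h4 : 0 < q ^ (N + 1) := by positivity
  nlinarith

theorem sum_lt_weights {q : ℝ} (hq : 0 < q) (hq1 : q < 1) (N b : ℕ) (hb : b ≤ N + 1) :
    1 - q ^ b ≤ ∑ p : Fin (N + 1), if (p : ℕ) < b then q ^ (p : ℕ) / geomSum q (N + 1) else 0 := by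
  have h := sum_window_weights hq hq1 N 0 b hb
  have h2 := one_sub_mul_geomSum q b
  simp only [Nat.Ico_zero_eq_range, zero_le, true_and] at h
  rw [geomSum] at h2
  rwa [← h2]

/-- Take the smallest remaining value `h` times in a row, each time with probability at least `1 -
q`. -/
theorem one_sub_pow_le_mallows_real {q : ℝ} (hq : 0 < q) (hq1 : q < 1) (N h : ℕ) (hh : h ≤ N) :
    (1 - q) ^ h ≤ (mallows N q).real (increasingAbove N h 0) := by
  induction N generalizing h with
  | zero =>
    obtain rfl : h = 0 := by omega
    have := isProbabilityMeasure_mallows 0 hq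
    simp [increasingAbove_zero]
  | succ N ih =>
    have := isProbabilityMeasure_mallows N hq
    have := isProbabilityMeasure_mallows (N + 1) hq
    cases h with
    | zero => simp [increasingAbove_zero]
    | succ h =>
      have hG := geomSum_pos hq N
      rw [mallows_real_succ N hq]
      refine le_trans (le_of_eq ?_) (mix_le_sum_mul (fun p : Fin (N + 1) =>
        q ^ (p : ℕ) / geomSum q (N + 1)) _ (fun p : Fin (N + 1) => (p : ℕ) < 1)
        (x := (1 - q) ^ h) (z := 0) (α := 1 - q) (fun p => by positivity)
        (sum_geom_weights N hq) (by simpa using sum_lt_weights hq hq1 N 1 (by omega)) ?_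
        (fun p => measureReal_nonneg) (pow_nonneg (by linarith) h))
      · ring
      · intro p hp
        refine (ih h (by omega)).trans (measureReal_mono fun e he => ?_)
        exact permCons_mem_increasingAbove_succ (by omega) (by omega) he

theorem mul_max_zero_mix {a x y u : ℝ} (ha : 0 ≤ a) (ha1 : a ≤ 1)
    (h : u ≤ a * x + (1 - a) * y) :
    max 0 u ≤ a * max 0 x + (1 - a) * max 0 y := by
  have h1 : 0 ≤ 1 - a := by linarith
  refine max_le (by positivity) (h.trans ?_)
  gcongr <;> exact le_max_right _ _

/-- Lower bound for the probability of a long increasing subsequence. The subsequence is collected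
greedily: the next entry is taken when its value is among the first `w` free values above the
threshold, and only while fewer than `R₀` free values lie below the threshold. -/
theorem mul_max_le_mallows_real_increasingAbove {q : ℝ} (hq : 0 < q) (hq1 : q < 1)
    {N₀ R₀ w : ℕ} (hN₀ : R₀ + w ≤ N₀) (hR₀ : 1 ≤ R₀) {δ p p' x b A : ℝ} (hp : 0 < p)
    (hpp' : p ≤ p') (hp' : p' ≤ 1) (hδ0 : 0 ≤ δ) (hδ : δ ≤ 1 - q ^ R₀)
    (hpw : p ≤ (1 - q) * (w * q ^ (R₀ + w))) (hA : 0 ≤ A)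
    (hA1 : 1 - δ * (1 - Real.exp (-x)) ≤ A) (hA2 : 1 - p' * (1 - Real.exp (w * x - b)) ≤ A)
    (hx : 0 ≤ x) (hwx : w * x ≤ b) (s h R : ℕ) (hR : R ≤ R₀ + w) :
    (p / p') ^ h * max 0 (1 - A ^ s * Real.exp (b * h + x * R)) ≤
      (mallows (N₀ + s) q).real (increasingAbove (N₀ + s) h R) := by
  have hp'0 : 0 < p' := hp.trans_le hpp'
  have hr0 : 0 ≤ p / p' := by positivity
  have hr1 : p / p' ≤ 1 := (div_le_one hp'0).2 hpp'
  have hb : 0 ≤ b := le_trans (by positivity) hwx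
  induction s generalizing h R with
  | zero =>
    -- With no steps left the potential is at least `1`, so the claimed bound is zero.
    rw [max_eq_left]
    · simp
    · have : 1 ≤ Real.exp (b * h + x * R) := Real.one_le_exp (by positivity)
      simpa using this
  | succ s ih =>
    have := isProbabilityMeasure_mallows (N₀ + (s + 1)) hq
    have := isProbabilityMeasure_mallows (N₀ + s) hq
    cases h with
    | zero =>
      have : 0 ≤ A ^ (s + 1) * Real.exp (b * (0 : ℕ) + x * R) := by positivity
      simp only [pow_zero, one_mul, increasingAbove_zero, probReal_univ]
      exact max_le zero_le_one (by linarith)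
    | succ h =>
      have hG := geomSum_pos hq (N₀ + s)
      rw [← add_assoc, mallows_real_succ _ hq]
      set r := p / p' with hr
      set u := A ^ s * Real.exp (b * (h + 1 : ℕ) + x * R) with hu
      have hu0 : 0 ≤ u := by positivity
      have hAu : A ^ (s + 1) * Real.exp (b * (h + 1 : ℕ) + x * R) = A * u := by
        rw [hu, pow_succ]; ring
      rw [hAu]
      have hz : ∀ i : Fin (N₀ + s + 1), r ^ (h + 1) * max 0 (1 - u) ≤ (mallows (N₀ + s) q).real
          {e | permCons i e ∈ increasingAbove (N₀ + s + 1) (h + 1) R} := fun i =>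
        (ih (h + 1) R hR).trans (measureReal_mono fun e he => permCons_mem_increasingAbove he)
      rcases le_or_gt R₀ R with hRR | hRR
      · have hδ' : δ ≤ 1 := by have : 0 < q ^ R₀ := by positivity
                               linarith
        have e1 : A ^ s * Real.exp (b * (h + 1 : ℕ) + x * (R - 1 : ℕ)) = u * Real.exp (-x) := by
          rw [hu, mul_assoc, ← Real.exp_add]; congr 2
          rw [Nat.cast_sub (by omega)]; push_cast; ring
        have hex : Real.exp (-x) ≤ 1 := Real.exp_le_one_iff.2 (by linarith)
        refine le_trans ?_ (mix_le_sum_mul (fun i : Fin (N₀ + s + 1) =>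
          q ^ (i : ℕ) / geomSum q (N₀ + s + 1)) _ (fun i : Fin (N₀ + s + 1) => (i : ℕ) < R)
          (x := r ^ (h + 1) * max 0 (1 - u * Real.exp (-x))) (z := r ^ (h + 1) * max 0 (1 - u))
          (α := δ) (fun i => by positivity) (sum_geom_weights _ hq) ?_ ?_ hz ?_)
        · calc r ^ (h + 1) * max 0 (1 - A * u) ≤ r ^ (h + 1) *
                (δ * max 0 (1 - u * Real.exp (-x)) + (1 - δ) * max 0 (1 - u)) := by
                refine mul_le_mul_of_nonneg_left (mul_max_zero_mix hδ0 hδ' ?_) (by positivity)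
                nlinarith
            _ = _ := by ring
        · refine le_trans ?_ (sum_lt_weights hq hq1 (N₀ + s) R (by omega))
          have : q ^ R ≤ q ^ R₀ := pow_le_pow_of_le_one hq.le hq1.le hRR
          linarith
        · intro i hi
          rw [← e1]
          exact (ih (h + 1) (R - 1) (by omega)).trans
            (measureReal_mono fun e he => permCons_mem_increasingAbove_of_lt hi he)
        · gcongr
          nlinarith
      · have e1 : A ^ s * Real.exp (b * h + x * (R + w : ℕ)) = u * Real.exp (w * x - b) := by
          rw [hu, mul_assoc, ← Real.exp_add]; congr 2
          push_cast; ring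
        have hex : Real.exp (w * x - b) ≤ 1 := Real.exp_le_one_iff.2 (by linarith)
        have hzy : max 0 (1 - u) ≤ max 0 (1 - u * Real.exp (w * x - b)) := by
          gcongr; nlinarith
        refine le_trans ?_ (mix_le_sum_mul (fun i : Fin (N₀ + s + 1) =>
          q ^ (i : ℕ) / geomSum q (N₀ + s + 1)) _
          (fun i : Fin (N₀ + s + 1) => R ≤ (i : ℕ) ∧ (i : ℕ) < R + w)
          (x := r ^ h * max 0 (1 - u * Real.exp (w * x - b))) (z := r ^ (h + 1) * max 0 (1 - u))
          (α := p) (fun i => by positivity) (sum_geom_weights _ hq) ?_ ?_ hz ?_)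
        · calc r ^ (h + 1) * max 0 (1 - A * u) ≤ r ^ (h + 1) *
                (p' * max 0 (1 - u * Real.exp (w * x - b)) + (1 - p') * max 0 (1 - u)) := by
                refine mul_le_mul_of_nonneg_left (mul_max_zero_mix hp'0.le hp' ?_) (by positivity)
                nlinarith
            _ = p * (r ^ h * max 0 (1 - u * Real.exp (w * x - b))) +
                (1 - p') * (r ^ (h + 1) * max 0 (1 - u)) := by
                -- This is the tilting: an acceptance weighted by `p` in place of `p'` is paid for
                -- by one factor `r`, and non-acceptance loses nothing because `1 - p' ≤ 1 - p`.
                have hpr : p' * r = p := by rw [hr]; field_simp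
                linear_combination
                  r ^ h * max 0 (1 - u * Real.exp (w * x - b)) * hpr
            _ ≤ _ := by gcongr
        -- The window has `w` ranks, all below `R₀ + w`, so each weight is at least `(1-q) q ^ (R₀ +
        -- w)`.
        · refine hpw.trans (le_trans ?_
            (sum_window_weights hq hq1 (N₀ + s) R (R + w) (by omega)))
          refine mul_le_mul_of_nonneg_left ?_ (by linarith)
          calc (w : ℝ) * q ^ (R₀ + w) = ∑ _k ∈ Finset.Ico R (R + w), q ^ (R₀ + w) := by simp
            _ ≤ _ := Finset.sum_le_sum fun k hk => by
                rw [Finset.mem_Ico] at hk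
                exact pow_le_pow_of_le_one hq.le hq1.le (by omega)
        · intro i hi
          rw [← e1]
          exact (ih h (R + w) (by omega)).trans
            (measureReal_mono fun e he => permCons_mem_increasingAbove_succ hi.1 hi.2.le he)
        · calc r ^ (h + 1) * max 0 (1 - u) ≤ r ^ h * max 0 (1 - u) := by
                gcongr ?_ * _
                exact pow_le_pow_of_le_one hr0 hr1 (by omega)
            _ ≤ _ := by gcongr

/-! ### Elementary estimates and choice of the greedy parameters -/

theorem half_le_one_sub_exp_neg {y : ℝ} (h0 : 0 ≤ y) (h1 : y ≤ 1) :
    y / 2 ≤ 1 - Real.exp (-y) := by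
  have h2 : 1 + y ≤ Real.exp y := by linarith [Real.add_one_le_exp y]
  have h3 : Real.exp (-y) ≤ 1 / (1 + y) := by
    rw [Real.exp_neg, ← one_div]; gcongr
  have h4 : 1 / (1 + y) ≤ 1 - y / 2 := by
    rw [div_le_iff₀ (by linarith)]; nlinarith
  linarith

theorem exp_neg_le_half {y : ℝ} (h : 1 ≤ y) : Real.exp (-y) ≤ 1 / 2 := by
  have h1 := half_le_one_sub_exp_neg zero_le_one le_rfl
  have h2 : Real.exp (-y) ≤ Real.exp (-1) := Real.exp_le_exp.2 (by linarith)
  linarith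

theorem one_div_le_pow {q : ℝ} (hq : 1 / 2 ≤ q) (hq1 : q ≤ 1) {k : ℕ} (hk : k * (1 - q) ≤ 2) :
    1 / 64 ≤ q ^ k := by
  have hq0 : 0 < q := by linarith
  have h1 : -(2 * (1 - q)) ≤ Real.log q := by
    refine le_trans ?_ (Real.one_sub_inv_le_log_of_pos hq0)
    have : q⁻¹ ≤ 2 := by rw [inv_le_comm₀ hq0 (by norm_num)]; linarith
    have h2 : q * q⁻¹ = 1 := mul_inv_cancel₀ hq0.ne'
    nlinarith
  have h2 : Real.exp (-4) ≤ q ^ k := by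
    rw [← Real.exp_log hq0, ← Real.exp_nat_mul]
    refine Real.exp_le_exp.2 ?_
    nlinarith [mul_le_mul_of_nonneg_left h1 (Nat.cast_nonneg (α := ℝ) k)]
  refine le_trans ?_ h2
  rw [Real.exp_neg, one_div]
  refine inv_anti₀ (Real.exp_pos _) ?_
  have h3 : Real.exp 4 = Real.exp 1 ^ 4 := by rw [← Real.exp_nat_mul]; norm_num
  rw [h3]
  calc Real.exp 1 ^ 4 ≤ 2.72 ^ 4 := by
        gcongr
        linarith [Real.exp_one_lt_d9]
    _ ≤ 64 := by norm_num

theorem pow_le_four_fifths {q : ℝ} (hq : 0 < q) {k : ℕ} (hk : 1 / 4 ≤ k * (1 - q)) :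
    q ^ k ≤ 4 / 5 := by
  calc q ^ k ≤ Real.exp (-(1 - q)) ^ k := by
        gcongr
        linarith [Real.add_one_le_exp (-(1 - q))]
    _ ≤ Real.exp (-(1 / 4)) := by
        rw [← Real.exp_nat_mul]
        exact Real.exp_le_exp.2 (by linarith)
    _ ≤ 4 / 5 := by
        rw [Real.exp_neg, inv_le_comm₀ (Real.exp_pos _) (by norm_num)]
        linarith [Real.add_one_le_exp (1 / 4 : ℝ)]

theorem increasingAbove_subset (n L R : ℕ) :
    increasingAbove n L R ⊆ {σ : Equiv.Perm (Fin n) | L ≤ LIS σ} := by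
  rintro σ ⟨i, h1, h2, -⟩
  exact (le_LIS_iff σ L).2 ⟨i, h1, h2⟩

/-- The greedy lower bound, run over the first half of the positions. -/
theorem mul_one_sub_exp_le_mallows_real {n : ℕ} {q : ℝ} (hn : 1 ≤ n) (hq : 1 / 2 ≤ q)
    (hqn : q ≤ 1 - 4 / (n : ℝ)) {w : ℕ} (hw : w * (1 - q) ≤ 1) {p p' x b : ℝ} (hp : 0 < p)
    (hpp' : p ≤ p') (hp' : p' ≤ 1) (hpw : p ≤ (1 - q) * w / 64) (hx : 0 ≤ x)
    (hA1 : p' / 2 ≤ 1 / 5 * (1 - Real.exp (-x))) (hA2 : Real.exp (w * x - b) ≤ 1 / 2) (L : ℕ) :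
    (p / p') ^ L * (1 - Real.exp (b * L - p' * n / 6)) ≤
      (mallows n q).real {σ | L ≤ LIS σ} := by
  have hn' : (0 : ℝ) < n := by exact_mod_cast hn
  have h4 : 0 < 4 / (n : ℝ) := by positivity
  have hq0 : 0 < q := by linarith
  have hq1 : q < 1 := by linarith
  have ht : 0 < 1 - q := by linarith
  have hnt : 4 ≤ n * (1 - q) := by
    have : 4 / (n : ℝ) ≤ 1 - q := by linarith
    rw [div_le_iff₀ hn'] at this; linarith
  have hn8 : 8 ≤ n := by
    have : (8 : ℝ) ≤ n := by nlinarith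
    exact_mod_cast this
  have := isProbabilityMeasure_mallows n hq0
  have hp'0 : 0 < p' := hp.trans_le hpp'
  -- Then `R₀(1-q)` lies in `[1/4, 3/4]`: the waiting probability is at least `1/5`, the window
  -- weights are at least `(1-q)/64`, and `R₀ + w` fits in half of the positions since `n(1-q) ≥ 4`.
  set R₀ := ⌈1 / (4 * (1 - q))⌉₊ with hR₀
  have hR1 : 1 / (4 * (1 - q)) ≤ R₀ := Nat.le_ceil _
  have hR2 : (R₀ : ℝ) < 1 / (4 * (1 - q)) + 1 := Nat.ceil_lt_add_one (by positivity)
  have hR3 : 1 / 4 ≤ R₀ * (1 - q) := by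
    rw [div_le_iff₀ (by positivity)] at hR1; linarith
  have hR4 : R₀ * (1 - q) ≤ 3 / 4 := by
    have := mul_lt_mul_of_pos_right hR2 ht
    have e : (1 / (4 * (1 - q)) + 1) * (1 - q) = 1 / 4 + (1 - q) := by field_simp
    linarith
  have hsum : R₀ + w ≤ n - n / 2 := by
    have : ((2 * (R₀ + w) : ℕ) : ℝ) ≤ n := by
      push_cast
      by_contra! hc
      nlinarith
    have : 2 * (R₀ + w) ≤ n := by exact_mod_cast this
    omega
  have hA : 0 ≤ 1 - p' / 2 := by linarith
  have hwx : w * x ≤ b := by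
    by_contra! hc
    have := Real.one_le_exp (x := w * x - b) (by linarith)
    linarith
  have key := mul_max_le_mallows_real_increasingAbove hq0 hq1 (N₀ := n - n / 2) hsum
    (Nat.ceil_pos.2 (by positivity)) (δ := 1 / 5) hp hpp' hp' (by norm_num)
    (by linarith [pow_le_four_fifths hq0 hR3])
    (hpw.trans (by
      have h64 := one_div_le_pow hq hq1.le (k := R₀ + w) (by push_cast; linarith)
      have : 0 ≤ (1 - q) * w := by positivity
      nlinarith)) hA (by linarith) (by nlinarith) hx hwx (n / 2) L 0 (Nat.zero_le _)
  rw [show n - n / 2 + n / 2 = n by omega] at key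
  refine le_trans ?_ (key.trans (measureReal_mono (increasingAbove_subset n L 0)))
  refine mul_le_mul_of_nonneg_left (le_trans ?_ (le_max_right _ _)) (by positivity)
  have hs : (n : ℝ) / 3 ≤ (n / 2 : ℕ) := by
    have : n ≤ 3 * (n / 2) := by omega
    have : (n : ℝ) ≤ 3 * (n / 2 : ℕ) := by exact_mod_cast this
    linarith
  have hAs : (1 - p' / 2) ^ (n / 2) ≤ Real.exp (-(p' * n / 6)) := by
    calc (1 - p' / 2) ^ (n / 2) ≤ Real.exp (-(p' / 2)) ^ (n / 2) := by
          gcongr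
          linarith [Real.add_one_le_exp (-(p' / 2))]
      _ ≤ _ := by
          rw [← Real.exp_nat_mul]
          exact Real.exp_le_exp.2 (by nlinarith)
  have e : Real.exp (b * L - p' * n / 6) =
      Real.exp (-(p' * n / 6)) * Real.exp (b * L + x * (0 : ℕ)) := by
    rw [← Real.exp_add]; congr 1; push_cast; ring
  rw [e]
  gcongr

/-- Greedy bound with `x = 1/w`, `b = 2`, `p' = 18L/n`: then `p'n/6 = 3L` beats `bL = 2L`, so the
tilted process succeeds with probability at least `1/2`. The bound on `wL` makes `p' ≤ 1/(5w)`, so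
that waiting compensates the rise of the threshold. -/
theorem pow_half_le_mallows_real {n : ℕ} {q : ℝ} (hn : 1 ≤ n) (hq : 1 / 2 ≤ q)
    (hqn : q ≤ 1 - 4 / (n : ℝ)) {w L : ℕ} (hw : w * (1 - q) ≤ 1) (hw1 : 1 ≤ w) (hL : 1 ≤ L)
    (hwL : (w : ℝ) * L ≤ n / 10000) {p : ℝ} (hp : 0 < p) (hpL : p ≤ 18 * L / n)
    (hpw : p ≤ (1 - q) * w / 64) :
    (p / (18 * L / n)) ^ L / 2 ≤ (mallows n q).real {σ | L ≤ LIS σ} := by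
  have hn' : (0 : ℝ) < n := by exact_mod_cast hn
  have hw' : (1 : ℝ) ≤ w := by exact_mod_cast hw1
  have hL' : (1 : ℝ) ≤ L := by exact_mod_cast hL
  have hwp : (w : ℝ) * (18 * L / n) ≤ 1 / 5 := by
    rw [← mul_div_assoc, div_le_iff₀ hn']; nlinarith
  have hp'0 : 0 < 18 * L / (n : ℝ) := by positivity
  have hA1 : 18 * L / n / 2 ≤ 1 / 5 * (1 - Real.exp (-(1 / (w : ℝ)))) := by
    have h1 := half_le_one_sub_exp_neg (y := 1 / (w : ℝ)) (by positivity)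
      ((div_le_one (by linarith)).2 hw')
    have h2 : 18 * L / (n : ℝ) ≤ 1 / 5 * (1 / w) := by
      rw [mul_one_div, le_div_iff₀ (by linarith)]; linarith
    linarith
  have hA2 : Real.exp (w * (1 / w) - 2) ≤ 1 / 2 := by
    rw [mul_one_div_cancel (by positivity)]
    convert exp_neg_le_half le_rfl using 2
    norm_num
  refine le_trans ?_ (mul_one_sub_exp_le_mallows_real hn hq hqn hw hp hpL (by nlinarith) hpw
    (by positivity) hA1 hA2 L)
  have e : 2 * (L : ℝ) - 18 * L / n * n / 6 = -L := by field_simp; ring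
  rw [e, div_eq_mul_one_div]
  have := exp_neg_le_half hL'
  gcongr
  linarith

/-! ### Lower bound for the upper tail, and the lower tail -/

theorem pow_le_mallows_real_le_LIS {n : ℕ} {q : ℝ} (hn : 1 ≤ n) (hq : 1 / 2 ≤ q)
    (hqn : q ≤ 1 - 4 / (n : ℝ)) {L : ℕ} (hL : n * √(1 - q) ≤ (L : ℝ)) (hLn : L ≤ n) :
    (1 / 100000000 * (1 - q) * (n : ℝ) ^ 2 / (L : ℝ) ^ 2) ^ L ≤
      (mallows n q).real {σ | L ≤ LIS σ} := by
  have hn' : (0 : ℝ) < n := by exact_mod_cast hn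
  have h4 : 0 < 4 / (n : ℝ) := by positivity
  have hq0 : 0 < q := by linarith
  have hq1 : q < 1 := by linarith
  have ht : 0 < 1 - q := by linarith
  have hS : 0 < √(1 - q) := Real.sqrt_pos.2 ht
  have hSS : √(1 - q) * √(1 - q) = 1 - q := Real.mul_self_sqrt ht.le
  have hL0 : (0 : ℝ) < L := lt_of_lt_of_le (by positivity) hL
  have hL1 : 1 ≤ L := by exact_mod_cast hL0
  have := isProbabilityMeasure_mallows n hq0
  have hLL : (1 - q) * n ^ 2 ≤ (L : ℝ) ^ 2 := by
    calc (1 - q) * n ^ 2 = (n * √(1 - q)) ^ 2 := by linear_combination -(n : ℝ) ^ 2 * hSS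
      _ ≤ _ := by gcongr
  -- For `L > n/10000` the ratio `n²/L²` is below `10⁸`, and `(1-q)^L` suffices.
  rcases lt_or_ge ((n : ℝ) / 10000) L with h | h
  · refine le_trans ?_ ((one_sub_pow_le_mallows_real hq0 hq1 n L hLn).trans
      (measureReal_mono (increasingAbove_subset n L 0)))
    have : 0 ≤ 1 / 100000000 * (1 - q) * (n : ℝ) ^ 2 / (L : ℝ) ^ 2 := by positivity
    refine pow_le_pow_left₀ this ?_ L
    rw [div_le_iff₀ (by positivity), mul_comm (1 / 100000000 : ℝ), mul_assoc]
    refine mul_le_mul_of_nonneg_left ?_ ht.le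
    nlinarith
  · have hy : 1 ≤ (n : ℝ) / 10000 / L := (one_le_div hL0).2 h
    -- The widest window with `wL ≤ n/10000`; rounding loses at most a factor `2`. The hypothesis `L
    -- ≥ n√(1-q)` gives `w√(1-q) ≤ 1`.
    set w := ⌊(n : ℝ) / 10000 / L⌋₊ with hw
    have hw1 : 1 ≤ w := Nat.le_floor (by simpa using hy)
    have hw1' : (1 : ℝ) ≤ w := by exact_mod_cast hw1
    have hwy : (w : ℝ) ≤ n / 10000 / L := Nat.floor_le (by positivity)
    have hwy2 : (n : ℝ) / 10000 / L ≤ 2 * w := by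
      linarith [Nat.lt_floor_add_one ((n : ℝ) / 10000 / L)]
    have hwL : (w : ℝ) * L ≤ n / 10000 := (le_div_iff₀ hL0).1 hwy
    have hwL2 : (n : ℝ) / 10000 ≤ 2 * w * L := (div_le_iff₀ hL0).1 hwy2
    have hS1 : √(1 - q) ≤ 1 := Real.sqrt_le_one.2 (by linarith)
    have hwt : w * (1 - q) ≤ 1 := by
      have h5 : w * √(1 - q) ≤ 1 := by
        by_contra! hc
        have : (n : ℝ) < w * (n * √(1 - q)) := by nlinarith
        have : w * (n * √(1 - q)) ≤ w * L := by gcongr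
        linarith
      calc w * (1 - q) = w * √(1 - q) * √(1 - q) := by rw [mul_assoc, hSS]
        _ ≤ 1 * 1 := by gcongr
        _ = 1 := one_mul 1
    refine le_trans ?_ (pow_half_le_mallows_real hn hq hqn hwt hw1 hL1 hwL
      (p := (1 - q) * w / 64) (by positivity) ?_ le_rfl)
    · have h2 : ((1 : ℝ) / 2) ^ L ≤ 1 / 2 := by
        simpa using pow_le_pow_of_le_one (by norm_num : (0 : ℝ) ≤ 1 / 2) (by norm_num) hL1
      have h3 : 1 / 100000000 * (1 - q) * (n : ℝ) ^ 2 / (L : ℝ) ^ 2 ≤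
          (1 - q) * w / 64 / (18 * L / n) * (1 / 2) := by
        have e : (1 - q) * w / 64 / (18 * L / n) * (1 / 2) =
            (1 - q) * (n / 2304) * (w * L) / (L : ℝ) ^ 2 := by field_simp; norm_num
        rw [e]
        gcongr ?_ / _
        have : 1 / 100000000 * (n : ℝ) ^ 2 ≤ n / 2304 * (w * L) := by nlinarith
        nlinarith
      have h4 : 0 ≤ 1 / 100000000 * (1 - q) * (n : ℝ) ^ 2 / (L : ℝ) ^ 2 := by positivity
      calc _ ≤ ((1 - q) * w / 64 / (18 * L / n) * (1 / 2)) ^ L := pow_le_pow_left₀ h4 h3 L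
        _ = ((1 - q) * w / 64 / (18 * L / n)) ^ L * (1 / 2) ^ L := mul_pow _ _ _
        _ ≤ ((1 - q) * w / 64 / (18 * L / n)) ^ L * (1 / 2) := by gcongr
        _ = _ := by ring
    · rw [le_div_iff₀ hn']
      have : (1 - q) * (w * L) * n ≤ (1 - q) * (n / 10000) * n := by gcongr
      have h6 : (1 - q) * w * n * L ≤ L * L := by nlinarith
      have h7 : (1 - q) * w * n ≤ L := le_of_mul_le_mul_right h6 hL0
      linarith

/-- Greedy bound without tilting (`p = p'`), so success has probability `1 - exp (bL - p'n/6)`. The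
lower bound on `L` gives `w(1-q) ≤ 1`; the upper one makes `(1-q)w²` large, so that `p'n/6`
dominates and has order `(1-q)n²/L`. -/
theorem mallows_real_LIS_lt_le {n : ℕ} {q : ℝ} (hn : 1 ≤ n) (hq : 1 / 2 ≤ q)
    (hqn : q ≤ 1 - 4 / (n : ℝ)) {L : ℕ} (hL : n * (1 - q) ≤ (L : ℝ))
    (hLn : (L : ℝ) ≤ 1 / 100000000 * n * √(1 - q)) :
    (mallows n q).real {σ | LIS σ < L} ≤
      Real.exp (-(1 / 100000000 * (1 - q) * (n : ℝ) ^ 2 / (L : ℝ))) := by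
  have hn' : (0 : ℝ) < n := by exact_mod_cast hn
  have h4 : 0 < 4 / (n : ℝ) := by positivity
  have hq0 : 0 < q := by linarith
  have hq1 : q < 1 := by linarith
  have ht : 0 < 1 - q := by linarith
  have hS : 0 < √(1 - q) := Real.sqrt_pos.2 ht
  have hS1 : √(1 - q) ≤ 1 := Real.sqrt_le_one.2 (by linarith)
  have hSS : √(1 - q) * √(1 - q) = 1 - q := Real.mul_self_sqrt ht.le
  have hL0 : (0 : ℝ) < L := lt_of_lt_of_le (by positivity) hL
  have := isProbabilityMeasure_mallows n hq0
  have hy : 1 ≤ (n : ℝ) / 10000 / L := (one_le_div hL0).2 (by nlinarith)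
  set w := ⌊(n : ℝ) / 10000 / L⌋₊ with hw
  have hw1 : 1 ≤ w := Nat.le_floor (by simpa using hy)
  have hw1' : (1 : ℝ) ≤ w := by exact_mod_cast hw1
  have hwy : (w : ℝ) ≤ n / 10000 / L := Nat.floor_le (by positivity)
  have hwy2 : (n : ℝ) / 10000 / L ≤ 2 * w := by
    linarith [Nat.lt_floor_add_one ((n : ℝ) / 10000 / L)]
  have hwL : (w : ℝ) * L ≤ n / 10000 := (le_div_iff₀ hL0).1 hwy
  have hwL2 : (n : ℝ) / 10000 ≤ 2 * w * L := (div_le_iff₀ hL0).1 hwy2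
  have hwt : w * (1 - q) ≤ 1 := by
    have h5 : w * (n * (1 - q)) ≤ n / 10000 := le_trans (by gcongr) hwL
    by_contra! hc
    nlinarith
  have hwS : 5000 ≤ w * √(1 - q) := by
    have h5 : 2 * w * L ≤ 2 * w * (1 / 100000000 * n * √(1 - q)) := by gcongr
    have h6 : (n : ℝ) * 5000 ≤ n * (w * √(1 - q)) := by linarith
    exact le_of_mul_le_mul_left h6 hn'
  have hwwt : 5000 * 5000 ≤ (1 - q) * (w : ℝ) ^ 2 := by
    rw [← hSS]; nlinarith
  have hx1 : 10 / 128 * ((1 - q) * w) ≤ 1 := by linarith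
  -- `x` is the value for which `p'/2 = x/10`, and `b = 2wx`, so the acceptance factor is `exp
  -- (-wx)`.
  have key := mul_one_sub_exp_le_mallows_real hn hq hqn hwt (p := (1 - q) * w / 64)
    (p' := (1 - q) * w / 64) (x := 10 / 128 * ((1 - q) * w)) (b := 10 / 64 * ((1 - q) * w ^ 2))
    (by positivity) le_rfl (by linarith) le_rfl (by positivity)
    (by linarith [half_le_one_sub_exp_neg (y := 10 / 128 * ((1 - q) * w)) (by positivity) hx1])
    (by
      refine le_trans (le_of_eq ?_)
        (exp_neg_le_half (y := 10 / 128 * ((1 - q) * w ^ 2)) (by linarith))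
      congr 1; ring) L
  rw [div_self (by positivity), one_pow, one_mul] at key
  have hcompl : {σ : Equiv.Perm (Fin n) | LIS σ < L} = {σ | L ≤ LIS σ}ᶜ := by
    ext σ; simp
  rw [hcompl, probReal_compl_eq_one_sub (MeasurableSet.of_discrete)]
  have hexp : Real.exp (10 / 64 * ((1 - q) * w ^ 2) * L - (1 - q) * w / 64 * n / 6) ≤
      Real.exp (-(1 / 100000000 * (1 - q) * (n : ℝ) ^ 2 / (L : ℝ))) := by
    refine Real.exp_le_exp.2 ?_
    have h5 : (1 - q) * w * (w * L) ≤ (1 - q) * w * (n / 10000) := by gcongr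
    have h6 : 1 / 100000000 * (1 - q) * (n : ℝ) ^ 2 / (L : ℝ) ≤ (1 - q) * w * n / 400 := by
      rw [div_le_iff₀ hL0]
      have : (1 - q) * n * (n / 10000) ≤ (1 - q) * n * (2 * w * L) := by gcongr
      have : 0 < (1 - q) * n * n := by positivity
      linarith
    have : 0 < (1 - q) * w * n := by positivity
    linarith
  linarith

/-! ### Bounds for the expectation -/

/-- Markov's inequality at `L` of order `n√(1-q)`, with window of order `1/√(1-q)` and `p = p'`,
where the success probability is at least `1/2`. If `n√(1-q) < 10000`, then `LIS ≥ 1` is enough. -/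
theorem le_integral_LIS {n : ℕ} {q : ℝ} (hn : 1 ≤ n) (hq : 1 / 2 ≤ q)
    (hqn : q ≤ 1 - 4 / (n : ℝ)) :
    1 / 40000 * ((n : ℝ) * √(1 - q)) ≤ ∫ σ, (LIS σ : ℝ) ∂(mallows n q) := by
  have hn' : (0 : ℝ) < n := by exact_mod_cast hn
  have h4 : 0 < 4 / (n : ℝ) := by positivity
  have hq0 : 0 < q := by linarith
  have ht : 0 < 1 - q := by linarith
  have hS : 0 < √(1 - q) := Real.sqrt_pos.2 ht
  have hS1 : √(1 - q) ≤ 1 := Real.sqrt_le_one.2 (by linarith)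
  have hSS : √(1 - q) * √(1 - q) = 1 - q := Real.mul_self_sqrt ht.le
  have := isProbabilityMeasure_mallows n hq0
  have hmarkov : ∀ L : ℕ, (L : ℝ) * (mallows n q).real {σ | L ≤ LIS σ} ≤
      ∫ σ, (LIS σ : ℝ) ∂(mallows n q) := fun L => by
    simpa using mul_meas_ge_le_integral_of_nonneg (μ := mallows n q)
      (f := fun σ => (LIS σ : ℝ)) (Filter.Eventually.of_forall fun σ => by positivity)
      Integrable.of_finite (L : ℝ)
  rcases lt_or_ge (n * √(1 - q) / 10000) 1 with h | h
  · have h1 : {σ : Equiv.Perm (Fin n) | 1 ≤ LIS σ} = Set.univ :=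
      Set.eq_univ_of_forall fun σ => (le_LIS_iff σ 1).2
        ⟨fun _ => ⟨0, hn⟩, Subsingleton.strictMono _, Subsingleton.strictMono _⟩
    have := hmarkov 1
    rw [h1, probReal_univ] at this
    push_cast at this
    linarith
  · set L := ⌊n * √(1 - q) / 10000⌋₊ with hL
    have hL1 : 1 ≤ L := Nat.le_floor (by simpa using h)
    have hLy : (L : ℝ) ≤ n * √(1 - q) / 10000 := Nat.floor_le (by positivity)
    have hL1' : (1 : ℝ) ≤ L := by exact_mod_cast hL1
    have hLy2 : n * √(1 - q) / 10000 ≤ 2 * L := by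
      linarith [Nat.lt_floor_add_one (n * √(1 - q) / 10000)]
    have hi : 1 ≤ 1 / √(1 - q) := (one_le_div hS).2 hS1
    set w := ⌊1 / √(1 - q)⌋₊ with hw
    have hw1 : 1 ≤ w := Nat.le_floor (by simpa using hi)
    have hw1' : (1 : ℝ) ≤ w := by exact_mod_cast hw1
    have hwS : w * √(1 - q) ≤ 1 := (le_div_iff₀ hS).1 (Nat.floor_le (by positivity))
    have hwS2 : 1 ≤ 2 * w * √(1 - q) := by
      rw [← div_le_iff₀ hS]
      linarith [Nat.lt_floor_add_one (1 / √(1 - q))]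
    have hwt : w * (1 - q) ≤ 1 := by
      calc w * (1 - q) = w * √(1 - q) * √(1 - q) := by rw [mul_assoc, hSS]
        _ ≤ 1 * 1 := by gcongr
        _ = 1 := one_mul 1
    have hwL : (w : ℝ) * L ≤ n / 10000 := by
      calc (w : ℝ) * L ≤ w * (n * √(1 - q) / 10000) := by gcongr
        _ = w * √(1 - q) * (n / 10000) := by ring
        _ ≤ 1 * (n / 10000) := by gcongr
        _ = _ := one_mul _
    have hp0 : 0 < 18 * L / (n : ℝ) := by positivity
    have hpw : 18 * L / (n : ℝ) ≤ (1 - q) * w / 64 := by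
      rw [div_le_iff₀ hn']
      have h5 : √(1 - q) ≤ 2 * w * (1 - q) := by
        have h6 := mul_le_mul_of_nonneg_right hwS2 hS.le
        rwa [mul_assoc, hSS, one_mul] at h6
      have h6 : n * √(1 - q) ≤ n * (2 * w * (1 - q)) := by gcongr
      have : 0 < n * √(1 - q) := by positivity
      linarith
    have key := pow_half_le_mallows_real hn hq hqn hwt hw1 hL1 hwL hp0 le_rfl hpw
    rw [div_self hp0.ne', one_pow] at key
    have := hmarkov L
    nlinarith

theorem integral_LIS_le {n : ℕ} {q : ℝ} (hn : 1 ≤ n) (hq : 1 / 2 ≤ q)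
    (hqn : q ≤ 1 - 4 / (n : ℝ)) :
    ∫ σ, (LIS σ : ℝ) ∂(mallows n q) ≤ 10 * ((n : ℝ) * √(1 - q)) := by
  have hn' : (0 : ℝ) < n := by exact_mod_cast hn
  have h4 : 0 < 4 / (n : ℝ) := by positivity
  have hq0 : 0 < q := by linarith
  have ht : 0 < 1 - q := by linarith
  have hS : 0 < √(1 - q) := Real.sqrt_pos.2 ht
  have hS1 : √(1 - q) ≤ 1 := Real.sqrt_le_one.2 (by linarith)
  have hSS : √(1 - q) * √(1 - q) = 1 - q := Real.mul_self_sqrt ht.le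
  have hnt : 4 ≤ n * (1 - q) := by
    have : 4 / (n : ℝ) ≤ 1 - q := by linarith
    rw [div_le_iff₀ hn'] at this; linarith
  have hnS : 4 ≤ n * √(1 - q) := by nlinarith [mul_pos hn' hS]
  have := isProbabilityMeasure_mallows n hq0
  -- With the factor `8`, the base of the tail bound is at most `32/64 = 1/2`; then `E LIS ≤ L + n
  -- P(LIS ≥ L)`, and the crude `2⁻ᴸ ≤ 1/L` controls the last term.
  set L := ⌈8 * (n * √(1 - q))⌉₊ with hL
  have hL1 : 8 * (n * √(1 - q)) ≤ L := Nat.le_ceil _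
  have hL2 : (L : ℝ) < 8 * (n * √(1 - q)) + 1 := Nat.ceil_lt_add_one (by positivity)
  have hL0 : (0 : ℝ) < L := by linarith
  have htail : n * (mallows n q).real {σ | L ≤ LIS σ} ≤ n * √(1 - q) := by
    have hbase : 32 * (1 - q) * (n : ℝ) ^ 2 / (L : ℝ) ^ 2 ≤ 1 / 2 := by
      rw [div_le_iff₀ (by positivity)]
      have : (8 * (n * √(1 - q))) ^ 2 ≤ (L : ℝ) ^ 2 := by gcongr
      have e : (8 * (n * √(1 - q))) ^ 2 = 64 * ((1 - q) * n ^ 2) := by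
        linear_combination 64 * (n : ℝ) ^ 2 * hSS
      linarith
    have h5 : (mallows n q).real {σ | L ≤ LIS σ} ≤ (1 / 2) ^ L :=
      (mallows_real_le_LIS_le hn hq hqn L).trans (pow_le_pow_left₀ (by positivity) hbase L)
    have h6 : ((1 : ℝ) / 2) ^ L ≤ 1 / L := by
      rw [one_div_pow]
      have : (L : ℝ) ≤ 2 ^ L := by exact_mod_cast (Nat.lt_two_pow_self (n := L)).le
      gcongr
    refine mul_le_mul_of_nonneg_left ((h5.trans h6).trans ?_) hn'.le
    rw [div_le_iff₀ hL0]
    have : √(1 - q) * (8 * (n * √(1 - q))) ≤ √(1 - q) * L := by gcongr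
    have e : √(1 - q) * (8 * (n * √(1 - q))) = 8 * (n * (√(1 - q) * √(1 - q))) := by ring
    rw [hSS] at e
    linarith
  have hint : ∫ σ, (LIS σ : ℝ) ∂(mallows n q) ≤
      ∫ σ, ((L : ℝ) + {σ : Equiv.Perm (Fin n) | L ≤ LIS σ}.indicator (fun _ => (n : ℝ)) σ)
        ∂(mallows n q) := by
    refine integral_mono Integrable.of_finite Integrable.of_finite fun σ => ?_
    by_cases h : L ≤ LIS σ
    · have : (LIS σ : ℝ) ≤ n := by exact_mod_cast LIS_le σ
      simp only [Set.indicator, Set.mem_ofPred_eq, h, if_true]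
      linarith
    · have : (LIS σ : ℝ) ≤ L := by exact_mod_cast (not_le.1 h).le
      simpa [Set.indicator, h] using this
  rw [integral_add Integrable.of_finite Integrable.of_finite,
    integral_indicator_const _ MeasurableSet.of_discrete] at hint
  simp only [integral_const, probReal_univ, smul_eq_mul, one_mul] at hint
  linarith

/-- `∫ σ, (LIS σ : ℝ) ∂(mallows n q)` and `(mallows n q).real {σ | …}` are the expectation of
`LIS(π)` and the probability of the event `…` for a random permutation `π` with law `mallows n q`. -/
theorem theorem1p3 :
    (∃ c C : ℝ, 0 < c ∧ c ≤ C ∧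
      ∀ (n : ℕ) (q : ℝ), 1 ≤ n → 1 / 2 ≤ q → q ≤ 1 - 4 / (n : ℝ) →
        c * ((n : ℝ) * √(1 - q)) ≤ ∫ σ, (LIS σ : ℝ) ∂(mallows n q) ∧
        ∫ σ, (LIS σ : ℝ) ∂(mallows n q) ≤ C * ((n : ℝ) * √(1 - q))) ∧
    (∃ c C : ℝ, 0 < c ∧ 0 < C ∧
      ∀ (n : ℕ) (q : ℝ), 1 ≤ n → 1 / 2 ≤ q → q ≤ 1 - 4 / (n : ℝ) →
        (∀ L : ℕ, C * (n : ℝ) * √(1 - q) ≤ (L : ℝ) →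
          (L ≤ n →
            (c * (1 - q) * (n : ℝ) ^ 2 / (L : ℝ) ^ 2) ^ L
              ≤ (mallows n q).real {σ | L ≤ LIS σ}) ∧
          (mallows n q).real {σ | L ≤ LIS σ}
            ≤ (C * (1 - q) * (n : ℝ) ^ 2 / (L : ℝ) ^ 2) ^ L) ∧
        (∀ L : ℕ, (n : ℝ) * (1 - q) ≤ (L : ℝ) → (L : ℝ) ≤ c * (n : ℝ) * √(1 - q) →
          (mallows n q).real {σ | LIS σ < L}
            ≤ Real.exp (-(c * (1 - q) * (n : ℝ) ^ 2 / (L : ℝ))))) := by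
  refine ⟨⟨1 / 40000, 10, by norm_num, by norm_num, fun n q hn hq hqn =>
    ⟨le_integral_LIS hn hq hqn, integral_LIS_le hn hq hqn⟩⟩,
    ⟨1 / 100000000, 32, by norm_num, by norm_num, fun n q hn hq hqn =>
    ⟨fun L hL => ⟨fun hLn => pow_le_mallows_real_le_LIS hn hq hqn ?_ hLn,
      mallows_real_le_LIS_le hn hq hqn L⟩,
      fun L hL hLn => mallows_real_LIS_lt_le hn hq hqn hL hLn⟩⟩⟩
  have : 0 ≤ (n : ℝ) * √(1 - q) := by positivity
  linarith
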